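/- **Theorem 1.4.** For a prime $p$, an $\mathsf{AC}^0[p]$ circuit on $n$ input bits is a directed acyclic graph (parallel edges allowed) whose input nodes are labelled by the literals $x_i,\neg x_i$ and whose gates are NOT gates and AND, OR and $\mathrm{MOD}_p$ gates of unbounded fan-in, with one designated output; a $\mathrm{MOD}_p$ gate outputs $1$ if and only if the number of ones among its inputs is divisible by $p$. The size $|C|$ of a circuit $C$ is its number of gates (of all kinds), and its depth is the maximal number of AND, OR and $\mathrm{MOD}_p$ gates on a path from an input to the output. Let $\mathrm{Parity}_n\colon\{0,1\}^n\to\{0,1\}$ be the function with $\mathrm{Parity}_n(x)=1$ if and only if the number of ones in $x$ is odd. There is an absolute constant $c>0$ such that for every odd prime $p$ there is an $n_0=n_0(p)$ such that the following holds for all integers $d\ge 1$ and $n\ge n_0$. If $C$ is an $\mathsf{AC}^0[p]$ circuit on $n$ input bits of depth at most $d$ with $C^{-1}(1)\subseteq \mathrm{Parity}_n^{-1}(1)$, then $$\Pr_{x\sim\{0,1\}^n}\bigl[C(x)=\mathrm{Parity}_n(x)\bigr]\;\le\;\frac12+|C|\cdot 2^{-n^{c/d}},$$ where $x$ is uniformly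 distributed on $\{0,1\}^n$. -/

import Mathlib

/-- A wire of a circuit on `n` input bits in which `k` gates are available: it carries either an
input literal (`lit i true` is `xᵢ`, `lit i false` is `¬xᵢ`) or the output of an available gate. -/
inductive Wire (n k : ℕ) : Type
  | lit (i : Fin n) (b : Bool) : Wire n k
  | gate (j : Fin k) : Wire n k

/-- The bit carried by a wire on input `x`, if `v` gives the values of the gates. -/
def Wire.eval {n k : ℕ} (x : Fin n → Bool) (v : Fin k → Bool) : Wire n k → Bool
  | .lit i b => x i == b
  | .gate j => v j

/-- The depth at which a wire starts, if `h` gives the depths of the gates. -/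
def Wire.depth {n k : ℕ} (h : Fin k → ℕ) : Wire n k → ℕ
  | .lit _ _ => 0
  | .gate j => h j

/-- A gate over the basis NOT, AND, OR, MOD_`p`; the last three have unbounded fan-in
(any finite list of wires, possibly empty and possibly with repetitions). -/
inductive Gate (p n k : ℕ) : Type
  | notGate (w : Wire n k) : Gate p n k
  | andGate (ws : List (Wire n k)) : Gate p n k
  | orGate (ws : List (Wire n k)) : Gate p n k
  | modGate (ws : List (Wire n k)) : Gate p n k

/-- The output of a gate. A MOD_`p` gate outputs `1` exactly when the number of ones among its
incoming wires is divisible by `p`. -/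
def Gate.eval {p n k : ℕ} (x : Fin n → Bool) (v : Fin k → Bool) : Gate p n k → Bool
  | .notGate w => !(w.eval x v)
  | .andGate ws => ws.all (fun w => w.eval x v)
  | .orGate ws => ws.any (fun w => w.eval x v)
  | .modGate ws => decide (p ∣ ws.countP (fun w => w.eval x v))

/-- The depth of a gate: AND, OR and MOD_`p` gates add one level, NOT gates add none. -/
def Gate.depth {p n k : ℕ} (h : Fin k → ℕ) : Gate p n k → ℕ
  | .notGate w => w.depth h
  | .andGate ws => (ws.map (fun w => w.depth h)).foldr max 0 + 1
  | .orGate ws => (ws.map (fun w => w.depth h)).foldr max 0 + 1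
  | .modGate ws => (ws.map (fun w => w.depth h)).foldr max 0 + 1

/-- A circuit on `n` input bits over the basis NOT, AND, OR, MOD_`p`: a directed acyclic graph of
gates, listed in a topological order (the incoming wires of gate `j` are input literals or outputs
of gates with index `< j`; every gate may be used any number of times), with an output wire.
`size` is the number of gates, of all four kinds. -/
structure ModCircuit (p n : ℕ) where
  size : ℕ
  gate : (j : Fin size) → Gate p n j
  output : Wire n size

namespace ModCircuit

variable {p n : ℕ}

/-- The value of gate `j` on input `x`. -/
def gateEval (C : ModCircuit p n) (x : Fin n → Bool) (j : Fin C.size) : Bool :=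
  (C.gate j).eval x (fun i : Fin j => C.gateEval x ⟨i, i.2.trans j.2⟩)
termination_by j.val
decreasing_by exact i.2

/-- The Boolean function computed by the circuit. -/
def eval (C : ModCircuit p n) (x : Fin n → Bool) : Bool :=
  C.output.eval x (C.gateEval x)

/-- The maximal number of AND, OR and MOD_`p` gates on a path from an input to gate `j`
(inclusive). -/
def gateDepth (C : ModCircuit p n) (j : Fin C.size) : ℕ :=
  (C.gate j).depth (fun i : Fin j => C.gateDepth ⟨i, i.2.trans j.2⟩)
termination_by j.val
decreasing_by exact i.2

/-- The depth of the circuit: the maximal number of AND, OR and MOD_`p` gates on a path from an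
input to the output. -/
def depth (C : ModCircuit p n) : ℕ :=
  C.output.depth C.gateDepth

end ModCircuit

/-- `parity x = 1` if and only if the number of ones in `x` is odd. -/
def parity {n : ℕ} (x : Fin n → Bool) : Bool :=
  decide (Odd (Finset.univ.filter (fun i => x i = true)).card)

/-- The probability that `f x = g x` for a uniformly random `x ∈ {0,1}ⁿ`. -/
noncomputable def agreement {n : ℕ} (f g : (Fin n → Bool) → Bool) : ℝ :=
  ((Finset.univ.filter (fun x : Fin n → Bool => f x = g x)).card : ℝ) / 2 ^ n

open Finset

/-! This is the Razborov–Smolensky method, with a dimension count adapted to one-sided error. Over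
F_p each gate is replaced by a Boolean function of low degree: a level multiplies the degree by at
most (p-1)t, and a gate errs on at most a 2^(-t) fraction of inputs. So C agrees with a Boolean g of
degree at most D = ((p-1)t)^depth outside a set E of density at most |C|/2^t
(`ModCircuit.exists_approx`).

Since C accepts only odd inputs, every even input accepted by g lies in E. The core is
`card_support_mul_ballCard_le`: the support of a low-degree P cannot lie almost entirely in the odd
inputs. If D + r < n/2, functions of degree at most r, restricted to supp P, span dimension at least
|supp P| times the density of the radius-r Hamming ball (`exists_lowDegree_subspace`). If this
exceeds the number of even points of supp P, some Q that is nonzero on supp P vanishes at all of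
them. Then PQ has degree below n/2 and vanishes on even inputs, so it is zero
(`eq_zero_of_lowDegree_of_even`), a contradiction.

For D small compared to √n, r can be taken so that the ball has density at least 1/4. Hence g
accepts at most 4|E| inputs and C at most 5|E|. The agreement with parity is 1/2 plus the density of
accepted inputs, and t ≈ n^(1/(8d)) gives the bound. -/

/-- The monomial `∏ i ∈ A, xᵢ` as a function on the Boolean cube. -/
def cubeMonomial (K : Type*) [CommRing K] {n : ℕ} (A : Finset (Fin n)) (x : Fin n → Bool) : K :=
  ∏ i ∈ A, if x i then 1 else 0

/-- The functions on the Boolean cube given by polynomials of degree at most `r`. -/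
def lowDegree (K : Type*) [CommRing K] (n r : ℕ) : Submodule K ((Fin n → Bool) → K) :=
  Submodule.span K (cubeMonomial K '' {A | A.card ≤ r})

/-- The character `∏ i ∈ A, (-1)^xᵢ` of the Boolean cube. -/
def cubeChar (K : Type*) [CommRing K] {n : ℕ} (A : Finset (Fin n)) (x : Fin n → Bool) : K :=
  ∏ i ∈ A, if x i then -1 else 1

/-! ### Degree and characters on the cube. -/

section LowDegree

variable {K : Type*} [CommRing K] {n : ℕ}

lemma cubeMonomial_eq_ite (A : Finset (Fin n)) (x : Fin n → Bool) :
    cubeMonomial K A x = if ∀ i ∈ A, x i = true then 1 else 0 := by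
  unfold cubeMonomial
  rw [Finset.prod_ite_zero]
  simp

lemma cubeMonomial_mul (A B : Finset (Fin n)) :
    cubeMonomial K A * cubeMonomial K B = cubeMonomial K (A ∪ B) := by
  funext x
  simp only [Pi.mul_apply, cubeMonomial_eq_ite, Finset.mem_union, or_imp, forall_and]
  split_ifs <;> simp_all

lemma cubeMonomial_mem {A : Finset (Fin n)} {r : ℕ} (h : A.card ≤ r) :
    cubeMonomial K A ∈ lowDegree K n r :=
  Submodule.subset_span ⟨A, h, rfl⟩

lemma lowDegree_mono {r s : ℕ} (h : r ≤ s) : lowDegree K n r ≤ lowDegree K n s :=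
  Submodule.span_mono (Set.image_mono fun _ hA => le_trans hA h)

lemma one_mem_lowDegree (r : ℕ) : (1 : (Fin n → Bool) → K) ∈ lowDegree K n r := by
  have : (1 : (Fin n → Bool) → K) = cubeMonomial K ∅ := by
    funext x; simp [cubeMonomial]
  rw [this]
  exact cubeMonomial_mem (by simp)

lemma mul_mem_lowDegree {r s : ℕ} {f g : (Fin n → Bool) → K} (hf : f ∈ lowDegree K n r)
    (hg : g ∈ lowDegree K n s) : f * g ∈ lowDegree K n (r + s) := by
  have h := Submodule.mul_mem_mul hf hg
  unfold lowDegree at h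
  rw [Submodule.span_mul_span] at h
  refine Submodule.span_le.2 ?_ h
  rintro _ ⟨_, ⟨A, hA, rfl⟩, _, ⟨B, hB, rfl⟩, rfl⟩
  simp only [cubeMonomial_mul]
  exact cubeMonomial_mem ((Finset.card_union_le _ _).trans (add_le_add hA hB))

lemma pow_mem_lowDegree {r : ℕ} {f : (Fin n → Bool) → K} (hf : f ∈ lowDegree K n r) (k : ℕ) :
    f ^ k ∈ lowDegree K n (r * k) := by
  induction k with
  | zero => simpa using one_mem_lowDegree 0
  | succ k ih =>
    rw [pow_succ, Nat.mul_succ]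
    exact mul_mem_lowDegree ih hf

lemma coord_mem_lowDegree (i : Fin n) :
    (fun x : Fin n → Bool => if x i then (1 : K) else 0) ∈ lowDegree K n 1 := by
  have : (fun x : Fin n → Bool => if x i then (1 : K) else 0) = cubeMonomial K {i} := by
    funext x; simp [cubeMonomial]
  rw [this]
  exact cubeMonomial_mem (by simp)

lemma cubeChar_mem_lowDegree (A : Finset (Fin n)) :
    cubeChar K A ∈ lowDegree K n A.card := by
  induction A using Finset.induction_on with
  | empty =>
    have : cubeChar K (∅ : Finset (Fin n)) = 1 := by funext x; simp [cubeChar]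
    rw [this]
    exact one_mem_lowDegree _
  | insert i A hi ih =>
    have : cubeChar K (insert i A) =
        cubeChar K A * (1 - (2 : K) • fun x : Fin n → Bool => if x i then (1 : K) else 0) := by
      funext x
      simp only [cubeChar, Finset.prod_insert hi, Pi.mul_apply, Pi.sub_apply, Pi.one_apply,
        Pi.smul_apply, smul_eq_mul]
      split_ifs <;> ring
    rw [this, Finset.card_insert_of_notMem hi]
    exact mul_mem_lowDegree ih (Submodule.sub_mem _ (one_mem_lowDegree _)
      (Submodule.smul_mem _ _ (coord_mem_lowDegree i)))

/-- A monomial of degree below n misses some variable; summing the sign of that variable over its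
two values gives 0. -/
lemma sum_cubeChar_univ_mul_eq_zero {r : ℕ} (hr : r < n) {f : (Fin n → Bool) → K}
    (hf : f ∈ lowDegree K n r) : ∑ x, cubeChar K univ x * f x = 0 := by
  induction hf using Submodule.span_induction with
  | mem f hf =>
    obtain ⟨A, hA, rfl⟩ := hf
    obtain ⟨i, hi⟩ : ∃ i, i ∉ A := by
      by_contra! h
      have : A = univ := Finset.eq_univ_iff_forall.2 h
      simp [this] at hA
      omega
    have h : ∀ x : Fin n → Bool, cubeChar K univ x * cubeMonomial K A x =
        ∏ j, (if x j then -1 else 1) * (if j ∈ A then if x j then (1 : K) else 0 else 1) := by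
      intro x
      rw [Finset.prod_mul_distrib, Finset.prod_ite_mem]
      simp [cubeChar, cubeMonomial]
    simp_rw [h]
    have key := Finset.prod_univ_sum (fun _ : Fin n => (univ : Finset Bool))
      (fun j b => (if b then -1 else 1) * (if j ∈ A then if b then (1 : K) else 0 else 1))
    rw [Fintype.piFinset_univ] at key
    rw [← key]
    exact Finset.prod_eq_zero (Finset.mem_univ i) (by simp [hi])
  | zero => simp
  | add f g _ _ hf hg => simp [mul_add, Finset.sum_add_distrib, hf, hg]
  | smul a f _ hf =>
    simp only [Pi.smul_apply, smul_eq_mul, mul_left_comm _ a, ← Finset.mul_sum, hf, mul_zero]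

lemma cubeChar_univ_eq (x : Fin n → Bool) :
    cubeChar K univ x = if parity x then -1 else 1 := by
  unfold cubeChar parity
  rw [Finset.prod_ite]
  simp only [Finset.prod_const, one_pow, mul_one, decide_eq_true_eq]
  split_ifs with h
  · exact h.neg_one_pow
  · exact (Nat.not_odd_iff_even.1 h).neg_one_pow

/-- Orthogonality of characters, for Fourier inversion without dividing by 2^n. -/
lemma sum_cubeChar_mul (a x : Fin n → Bool) :
    ∑ A : Finset (Fin n), cubeChar K A a * cubeChar K A x = if x = a then 2 ^ n else 0 := by
  have h : ∀ A : Finset (Fin n), cubeChar K A a * cubeChar K A x =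
      ∏ i ∈ A, ((if a i then -1 else 1) * if x i then (-1 : K) else 1) := fun A => by
    rw [Finset.prod_mul_distrib]; rfl
  simp_rw [h, ← Finset.powerset_univ, ← Finset.prod_one_add]
  split_ifs with hx
  · subst hx
    have : ∀ i, (1 + (if x i then -1 else 1) * if x i then (-1 : K) else 1) = 2 := by
      intro i; split_ifs <;> norm_num
    simp_rw [this]
    simp
  · obtain ⟨i, hi⟩ := Function.ne_iff.1 hx
    refine Finset.prod_eq_zero (Finset.mem_univ i) ?_
    cases h1 : x i <;> cases h2 : a i <;> simp_all

lemma cubeChar_compl (A : Finset (Fin n)) (x : Fin n → Bool) :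
    cubeChar K A x = cubeChar K univ x * cubeChar K Aᶜ x := by
  have h : cubeChar K univ x = cubeChar K A x * cubeChar K Aᶜ x :=
    (Finset.prod_mul_prod_compl A _).symm
  rw [h, mul_assoc]
  have : cubeChar K Aᶜ x * cubeChar K Aᶜ x = 1 := by
    unfold cubeChar
    rw [← Finset.prod_mul_distrib]
    refine Finset.prod_eq_one fun i _ => ?_
    split_ifs <;> norm_num
  rw [this, mul_one]

end LowDegree

/-! ### Low-degree functions vanishing on even inputs. -/

section Field

variable {K : Type*} [Field K] {n : ℕ}

/-- A function of degree less than `n / 2` that vanishes on all inputs of even weight is zero. -/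
theorem eq_zero_of_lowDegree_of_even (h2 : (2 : K) ≠ 0) {r : ℕ} (hr : 2 * r < n)
    {f : (Fin n → Bool) → K} (hf : f ∈ lowDegree K n r) (h0 : ∀ x, parity x = false → f x = 0) :
    f = 0 := by
  have hcoef : ∀ A : Finset (Fin n), ∑ x, cubeChar K A x * f x = 0 := by
    intro A
    -- On the support of `f` the full character is -1, so the coefficient at A is minus the one at
    -- Aᶜ, which the degree bound kills when |A| ≤ r. For |A| > r the degree bound kills the
    -- coefficient at A itself.
    by_cases hA : A.card ≤ r
    · have h := sum_cubeChar_univ_mul_eq_zero (by omega : A.card + r < n)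
        (mul_mem_lowDegree (cubeChar_mem_lowDegree A) hf)
      rw [← neg_eq_zero, ← Finset.sum_neg_distrib, ← h]
      refine Finset.sum_congr rfl fun x _ => ?_
      rw [cubeChar_univ_eq, Pi.mul_apply]
      cases hx : parity x
      · simp [h0 x hx]
      · simp
    · have hc := Finset.card_add_card_compl A
      rw [Fintype.card_fin] at hc
      have h := sum_cubeChar_univ_mul_eq_zero (by omega : Aᶜ.card + r < n)
        (mul_mem_lowDegree (cubeChar_mem_lowDegree Aᶜ) hf)
      rw [← h]
      refine Finset.sum_congr rfl fun x _ => ?_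
      rw [cubeChar_compl A, Pi.mul_apply, mul_assoc]
  funext a
  have : (2 : K) ^ n * f a = 0 := by
    calc (2 : K) ^ n * f a
        = ∑ x, (∑ A : Finset (Fin n), cubeChar K A a * cubeChar K A x) * f x := by
          simp [sum_cubeChar_mul]
      _ = ∑ A : Finset (Fin n), cubeChar K A a * ∑ x, cubeChar K A x * f x := by
          simp_rw [Finset.sum_mul, Finset.mul_sum]
          rw [Finset.sum_comm]
          simp_rw [mul_assoc]
      _ = 0 := by simp [hcoef]
  exact (mul_eq_zero.1 this).resolve_left (pow_ne_zero _ h2)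

end Field

/-! ### Dimension of low-degree functions on a subset of the cube. -/

/-- The number of subsets of an `n`-element set with at most `r` elements. -/
def ballCard (n r : ℕ) : ℕ := ∑ i ∈ range (r + 1), n.choose i

lemma ballCard_zero_right (n : ℕ) : ballCard n 0 = 1 := by simp [ballCard]

lemma ballCard_zero_left (r : ℕ) : ballCard 0 r = 1 := by
  simp [ballCard, Finset.sum_range_succ']

lemma ballCard_succ (n r : ℕ) :
    ballCard (n + 1) (r + 1) = ballCard n (r + 1) + ballCard n r := by
  unfold ballCard
  rw [Finset.sum_range_succ' _ (r + 1), Finset.sum_range_succ' (n.choose) (r + 1)]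
  simp only [Nat.choose_succ_succ', Finset.sum_add_distrib, Nat.choose_zero_right]
  ring

lemma ballCard_mono (n : ℕ) {r s : ℕ} (h : r ≤ s) : ballCard n r ≤ ballCard n s :=
  Finset.sum_le_sum_of_subset (Finset.range_mono (by omega))

section

variable {K : Type*} [Field K] {n : ℕ}

lemma comp_tail_mem_lowDegree {r : ℕ} {f : (Fin n → Bool) → K} (hf : f ∈ lowDegree K n r) :
    (fun x : Fin (n + 1) → Bool => f (Fin.tail x)) ∈ lowDegree K (n + 1) r := by
  induction hf using Submodule.span_induction with
  | mem f hf =>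
    obtain ⟨A, hA, rfl⟩ := hf
    have : (fun x : Fin (n + 1) → Bool => cubeMonomial K A (Fin.tail x)) =
        cubeMonomial K (A.map (Fin.succEmb n)) := by
      funext x
      simp only [cubeMonomial, Finset.prod_map]
      rfl
    rw [this]
    exact cubeMonomial_mem (by simpa using hA)
  | zero => exact Submodule.zero_mem _
  | add f g _ _ hf hg => exact Submodule.add_mem _ hf hg
  | smul a f _ hf => exact Submodule.smul_mem _ a hf

/-- The linear map sending `(f, g)` to the function `f + x₀ g` in one more variable. -/
def addVar (K : Type*) [Field K] (n : ℕ) :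
    ((Fin n → Bool) → K) × ((Fin n → Bool) → K) →ₗ[K] ((Fin (n + 1) → Bool) → K) where
  toFun q x := q.1 (Fin.tail x) + (if x 0 then 1 else 0) * q.2 (Fin.tail x)
  map_add' q q' := by funext x; simp only [Prod.fst_add, Prod.snd_add, Pi.add_apply]; ring
  map_smul' a q := by
    funext x
    simp only [Prod.smul_fst, Prod.smul_snd, Pi.smul_apply, smul_eq_mul, RingHom.id_apply]
    ring

lemma addVar_cons (q : ((Fin n → Bool) → K) × ((Fin n → Bool) → K)) (b : Bool)
    (y : Fin n → Bool) :
    addVar K n q (Fin.cons b y : Fin (n + 1) → Bool) = q.1 y + (if b then 1 else 0) * q.2 y := by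
  simp [addVar, Fin.tail_cons]

lemma addVar_injective : Function.Injective (addVar K n) := by
  rw [← LinearMap.ker_eq_bot, LinearMap.ker_eq_bot']
  intro q hq
  have h (b : Bool) (y : Fin n → Bool) := congrFun hq (Fin.cons b y : Fin (n + 1) → Bool)
  simp only [addVar_cons, Pi.zero_apply] at h
  have h1 : q.1 = 0 := by funext y; simpa using h false y
  have h2 : q.2 = 0 := by funext y; simpa [h1] using h true y
  exact Prod.ext h1 h2

lemma addVar_mem_lowDegree {r : ℕ} {f g : (Fin n → Bool) → K} (hf : f ∈ lowDegree K n (r + 1))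
    (hg : g ∈ lowDegree K n r) : addVar K n (f, g) ∈ lowDegree K (n + 1) (r + 1) := by
  refine Submodule.add_mem _ (comp_tail_mem_lowDegree hf) ?_
  rw [add_comm r 1]
  exact mul_mem_lowDegree (coord_mem_lowDegree 0) (comp_tail_mem_lowDegree hg)

lemma card_eq_card_cons_add (S : Finset (Fin (n + 1) → Bool)) :
    S.card = (univ.filter fun y : Fin n → Bool => (Fin.cons false y : Fin (n + 1) → Bool) ∈ S).card +
      (univ.filter fun y : Fin n → Bool => (Fin.cons true y : Fin (n + 1) → Bool) ∈ S).card := by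
  classical
  have key (b : Bool) :
      (univ.filter fun y : Fin n → Bool => (Fin.cons b y : Fin (n + 1) → Bool) ∈ S).card =
      (S.filter fun x => x 0 = b).card := by
    refine Finset.card_bij (fun y _ => (Fin.cons b y : Fin (n + 1) → Bool)) ?_ ?_ ?_
    · intro y hy; simpa using hy
    · intro y _ y' _ h; exact (Fin.cons_injective2 h).2
    · intro x hx
      rw [Finset.mem_filter] at hx
      refine ⟨Fin.tail x, ?_, ?_⟩
      · rw [Finset.mem_filter, ← hx.2, Fin.cons_self_tail]
        exact ⟨Finset.mem_univ _, hx.1⟩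
      · rw [← hx.2, Fin.cons_self_tail]
  have h := Finset.card_filter_add_card_filter_not (s := S) (fun x => x 0 = true)
  simp only [Bool.not_eq_true] at h
  rw [key, key, ← h, Nat.add_comm]

/-- The space of functions of degree at most `r` restricted to a subset `S` of the cube has
dimension at least `|S|` times the density of the Hamming ball of radius `r`. -/
theorem exists_lowDegree_subspace (n r : ℕ) (S : Finset (Fin n → Bool)) :
    ∃ W ≤ lowDegree K n r, (∀ f ∈ W, (∀ x ∈ S, f x = 0) → f = 0) ∧
      S.card * ballCard n r ≤ Module.finrank K W * 2 ^ n := by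
  classical
  -- When the ball is a single point, constants suffice, unless S is empty.
  have hconst : ∀ (n r : ℕ) (S : Finset (Fin n → Bool)), ballCard n r = 1 →
      ∃ W ≤ lowDegree K n r, (∀ f ∈ W, (∀ x ∈ S, f x = 0) → f = 0) ∧
        S.card * ballCard n r ≤ Module.finrank K W * 2 ^ n := by
    intro n r S h
    rcases S.eq_empty_or_nonempty with rfl | ⟨a, ha⟩
    · exact ⟨⊥, bot_le, fun f hf _ => (Submodule.mem_bot K).1 hf, by simp⟩
    · refine ⟨Submodule.span K {1}, ?_, ?_, ?_⟩
      · rw [Submodule.span_singleton_le_iff_mem]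
        exact one_mem_lowDegree r
      · intro f hf h0
        obtain ⟨c, rfl⟩ := Submodule.mem_span_singleton.1 hf
        have := h0 a ha
        simp only [Pi.smul_apply, Pi.one_apply, smul_eq_mul, mul_one] at this
        rw [this, zero_smul]
      · rw [h, finrank_span_singleton one_ne_zero, mul_one, one_mul]
        simpa using Finset.card_le_univ S
  induction n generalizing r with
  | zero => exact hconst 0 r S (ballCard_zero_left r)
  | succ n ih =>
    cases r with
    | zero => exact hconst _ _ S (ballCard_zero_right _)
    | succ r =>
      have hS := card_eq_card_cons_add S
      set S₀ := univ.filter fun y : Fin n → Bool => (Fin.cons false y : Fin (n + 1) → Bool) ∈ S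
        with hS₀
      set S₁ := univ.filter fun y : Fin n → Bool => (Fin.cons true y : Fin (n + 1) → Bool) ∈ S
        with hS₁
      -- In f + x₀g, take f determined by its values on the union of the two slices and g by its
      -- values on their intersection: there both f and f + g are seen, so vanishing on S forces g =
      -- 0 first and then f = 0.
      obtain ⟨W₁, hW₁, h₁, c₁⟩ := ih (r + 1) (S₀ ∪ S₁)
      obtain ⟨W₂, hW₂, h₂, c₂⟩ := ih r (S₀ ∩ S₁)
      refine ⟨LinearMap.range ((addVar K n).comp (W₁.subtype.prodMap W₂.subtype)), ?_, ?_, ?_⟩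
      · rintro _ ⟨⟨⟨f, hf⟩, ⟨g, hg⟩⟩, rfl⟩
        exact addVar_mem_lowDegree (hW₁ hf) (hW₂ hg)
      · rintro _ ⟨⟨⟨f, hf⟩, ⟨g, hg⟩⟩, rfl⟩ h0
        change addVar K n (f, g) = 0
        change ∀ x ∈ S, addVar K n (f, g) x = 0 at h0
        have hf0 : ∀ y ∈ S₀, f y = 0 := by
          intro y hy
          simpa [addVar_cons] using h0 _ (Finset.mem_filter.1 hy).2
        have hfg : ∀ y ∈ S₁, f y + g y = 0 := by
          intro y hy
          simpa [addVar_cons] using h0 _ (Finset.mem_filter.1 hy).2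
        have hg0 : g = 0 := h₂ g hg fun y hy => by
          rw [Finset.mem_inter] at hy
          simpa [hf0 y hy.1] using hfg y hy.2
        have hf0 : f = 0 := h₁ f hf fun y hy => by
          rcases Finset.mem_union.1 hy with hy | hy
          · exact hf0 y hy
          · simpa [hg0] using hfg y hy
        rw [hf0, hg0]
        exact map_zero _
      · rw [LinearMap.finrank_range_of_inj, Module.finrank_prod]
        swap
        · exact addVar_injective.comp
            (Function.Injective.prodMap W₁.injective_subtype W₂.injective_subtype)
        rw [hS, ← Finset.card_union_add_card_inter, ballCard_succ, pow_succ]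
        have hu : (S₀ ∩ S₁).card ≤ (S₀ ∪ S₁).card :=
          Finset.card_le_card (Finset.inter_subset_left.trans Finset.subset_union_left)
        have hb : ballCard n r ≤ ballCard n (r + 1) := ballCard_mono n (Nat.le_succ r)
        -- Rearrangement inequality: union and larger ball are paired, so (u + i)(b' + b) ≤ 2(ub' +
        -- ib).
        nlinarith [mul_add_mul_le_mul_add_mul' hu hb]

/-- If `P` has degree at most `D`, then its support is not much larger than the set of inputs of
even weight in its support. -/
theorem card_support_mul_ballCard_le (h2 : (2 : K) ≠ 0) [DecidableEq K] {D r : ℕ}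
    (hr : 2 * (D + r) < n) {P : (Fin n → Bool) → K} (hP : P ∈ lowDegree K n D) :
    (univ.filter fun x => P x ≠ 0).card * ballCard n r ≤
      (univ.filter fun x => parity x = false ∧ P x ≠ 0).card * 2 ^ n := by
  obtain ⟨W, hW, hinj, hc⟩ := exists_lowDegree_subspace (K := K) n r (univ.filter fun x => P x ≠ 0)
  by_contra! hlt
  set E := univ.filter fun x => parity x = false ∧ P x ≠ 0 with hE
  have hdim : E.card < Module.finrank K W :=
    lt_of_mul_lt_mul_right (hlt.trans_le hc) (Nat.zero_le _)
  -- Restriction to E has a kernel, because dim W > |E|.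
  let ρ : W →ₗ[K] (E → K) := (LinearMap.funLeft K K (Subtype.val : E → _)).comp W.subtype
  obtain ⟨Q, hQ, hQ0⟩ : ∃ Q ∈ LinearMap.ker ρ, Q ≠ 0 := by
    refine (Submodule.ne_bot_iff _).1 fun hbot => ?_
    have := LinearMap.finrank_le_finrank_of_injective (LinearMap.ker_eq_bot.1 hbot)
    simp at this
    omega
  refine hQ0 (Subtype.ext (hinj Q.1 Q.2 ?_))
  have hPQ : P * Q.1 = 0 := by
    refine eq_zero_of_lowDegree_of_even h2 hr (mul_mem_lowDegree hP (hW Q.2)) fun x hx => ?_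
    by_cases hPx : P x = 0
    · simp [hPx]
    · have hxE : x ∈ E := by simp [hE, hx, hPx]
      have : Q.1 x = 0 := congrFun (LinearMap.mem_ker.1 hQ) ⟨x, hxE⟩
      simp [this]
  intro x hx
  have := congrFun hPQ x
  simpa [(Finset.mem_filter.1 hx).2] using this

end

/-! ### Hamming balls of radius close to n/2. -/

/-- The induction step reduces to (2m+1)(2m+3) ≤ 4(m+1)². -/
lemma centralBinom_sq_mul_le (m : ℕ) : m.centralBinom ^ 2 * (2 * m + 1) ≤ 16 ^ m := by
  induction m with
  | zero => simp
  | succ m ih =>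
    have h := Nat.succ_mul_centralBinom_succ m
    refine le_of_mul_le_mul_left ?_ (by positivity : 0 < (m + 1) ^ 2)
    calc (m + 1) ^ 2 * ((m + 1).centralBinom ^ 2 * (2 * (m + 1) + 1))
        = ((m + 1) * (m + 1).centralBinom) ^ 2 * (2 * m + 3) := by ring
      _ = (m.centralBinom ^ 2 * (2 * m + 1)) * (4 * ((2 * m + 1) * (2 * m + 3))) := by
          rw [h]; ring
      _ ≤ 16 ^ m * (4 * (4 * (m + 1) ^ 2)) := Nat.mul_le_mul ih (by nlinarith)
      _ = (m + 1) ^ 2 * 16 ^ (m + 1) := by ring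

lemma choose_half_sq_mul_le (n : ℕ) : n.choose (n / 2) ^ 2 * (n + 1) ≤ 4 ^ n := by
  rcases Nat.even_or_odd' n with ⟨m, rfl | rfl⟩
  · have h := centralBinom_sq_mul_le m
    rw [Nat.centralBinom_eq_two_mul_choose] at h
    rw [Nat.mul_div_cancel_left m two_pos, pow_mul]
    exact h
  · have h := centralBinom_sq_mul_le (m + 1)
    have hd : (2 * m + 1) / 2 = m := by omega
    have hc : (m + 1).centralBinom = 2 * (2 * m + 1).choose m := by
      rw [Nat.centralBinom_eq_two_mul_choose, show 2 * (m + 1) = 2 * m + 1 + 1 by ring,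
        Nat.choose_succ_succ', Nat.choose_symm_half]
      ring
    rw [hc] at h
    rw [hd]
    have h16 : 16 ^ (m + 1) = 4 * 4 ^ (2 * m + 1) := by
      rw [pow_succ 4 (2 * m), pow_mul]
      norm_num
      ring
    rw [h16] at h
    nlinarith

/-- By symmetry the top levels form a second ball; the n-1-2r levels between are each at most the
middle one. -/
lemma two_pow_le_ballCard {n r : ℕ} (hr : 2 * r < n) :
    2 ^ n ≤ 2 * ballCard n r + (n - 1 - 2 * r) * n.choose (n / 2) := by
  have hmid : ∑ i ∈ Ico (r + 1) (n - r), n.choose i ≤ (n - 1 - 2 * r) * n.choose (n / 2) := by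
    calc _ ≤ ∑ i ∈ Ico (r + 1) (n - r), n.choose (n / 2) :=
          Finset.sum_le_sum fun i _ => Nat.choose_le_middle i n
      _ = _ := by simp; left; omega
  have htop : ∑ i ∈ Ico (n - r) (n + 1), n.choose i = ballCard n r := by
    unfold ballCard
    refine Finset.sum_bij' (fun i _ => n - i) (fun i _ => n - i) ?_ ?_ ?_ ?_ ?_
    · intro i hi; rw [Finset.mem_Ico] at hi; rw [Finset.mem_range]; omega
    · intro i hi; rw [Finset.mem_range] at hi; rw [Finset.mem_Ico]; omega
    · intro i hi; rw [Finset.mem_Ico] at hi; omega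
    · intro i hi; rw [Finset.mem_range] at hi; omega
    · intro i hi; rw [Finset.mem_Ico] at hi; exact (Nat.choose_symm (by omega)).symm
  rw [← Nat.sum_range_choose n, ← Finset.sum_range_add_sum_Ico _ (by omega : n - r ≤ n + 1), htop,
    ← Finset.sum_range_add_sum_Ico _ (by omega : r + 1 ≤ n - r)]
  change ballCard n r + _ + _ ≤ _
  omega

/-- At most 2D+2 levels lie between the two balls, each of size at most 2^n/√(n+1), so together they
fill at most half of the cube. -/
lemma two_pow_le_four_mul_ballCard {n D : ℕ} (hD : 16 * (D + 1) ^ 2 ≤ n) :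
    2 ^ n ≤ 4 * ballCard n ((n - 1) / 2 - D) := by
  have hDn : 4 * D + 4 ≤ n := by nlinarith
  have h := two_pow_le_ballCard (n := n) (r := (n - 1) / 2 - D) (by omega)
  have hle : (n - 1 - 2 * ((n - 1) / 2 - D)) * n.choose (n / 2) ≤
      (2 * D + 2) * n.choose (n / 2) := Nat.mul_le_mul_right _ (by omega)
  have hsq : ((4 * D + 4) * n.choose (n / 2)) ^ 2 ≤ (2 ^ n) ^ 2 := by
    calc ((4 * D + 4) * n.choose (n / 2)) ^ 2 = n.choose (n / 2) ^ 2 * (16 * (D + 1) ^ 2) := by ring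
      _ ≤ n.choose (n / 2) ^ 2 * (n + 1) := Nat.mul_le_mul_left _ (by omega)
      _ ≤ 4 ^ n := choose_half_sq_mul_le n
      _ = (2 ^ n) ^ 2 := by rw [← pow_mul, mul_comm, pow_mul]; norm_num
  have := (Nat.pow_le_pow_iff_left two_ne_zero).1 hsq
  nlinarith

lemma card_cube (n : ℕ) : (univ : Finset (Fin n → Bool)).card = 2 ^ n := by simp

/-! ### Low-degree approximation of gates. -/

/-- The indicator function of a Boolean function. -/
def boolIndicator (K : Type*) [CommRing K] {n : ℕ} (g : (Fin n → Bool) → Bool)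
    (x : Fin n → Bool) : K :=
  if g x then 1 else 0

section Approximation

/-- If some function of the list is nonzero at every point of `X`, then some linear combination
is nonzero on at least half of `X`. -/
lemma exists_combination_half {K α : Type*} [Field K] [DecidableEq K] [DecidableEq α] (V : Submodule K (α → K))
    (hs : List (α → K)) (hV : ∀ h ∈ hs, h ∈ V) (X : Finset α)
    (hX : ∀ x ∈ X, ∃ h ∈ hs, h x ≠ 0) :
    ∃ l ∈ V, (∀ x, (∀ h ∈ hs, h x = 0) → l x = 0) ∧
      2 * (X.filter fun x => l x = 0).card ≤ X.card := by
  induction hs generalizing X with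
  | nil =>
    have : X = ∅ := Finset.eq_empty_of_forall_notMem fun x hx => by simpa using hX x hx
    exact ⟨0, V.zero_mem, by simp, by simp [this]⟩
  | cons h hs ih =>
    obtain ⟨l, hl, hl0, hlX⟩ := ih (fun g hg => hV g (List.mem_cons_of_mem _ hg))
      (X.filter fun x => h x = 0) (by
        intro x hx
        rw [Finset.mem_filter] at hx
        obtain ⟨g, hg, hgx⟩ := hX x hx.1
        rcases List.mem_cons.1 hg with rfl | hg
        · exact absurd hx.2 hgx
        · exact ⟨g, hg, hgx⟩)
    have hsplit : ∀ l' : α → K, (X.filter fun x => l' x = 0).card =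
        ((X.filter fun x => h x = 0).filter fun x => l' x = 0).card +
        ((X.filter fun x => ¬ h x = 0).filter fun x => l' x = 0).card := by
      intro l'
      rw [← Finset.card_filter_add_card_filter_not (s := X.filter fun x => l' x = 0)
        (fun x => h x = 0), Finset.filter_comm, Finset.filter_comm (fun x => l' x = 0)]
    have hsame : ((X.filter fun x => h x = 0).filter fun x => (l + h) x = 0) =
        ((X.filter fun x => h x = 0).filter fun x => l x = 0) := by
      refine Finset.filter_congr fun x hx => ?_
      simp [(Finset.mem_filter.1 hx).2]
    have hdisj : ((X.filter fun x => ¬ h x = 0).filter fun x => l x = 0).card +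
        ((X.filter fun x => ¬ h x = 0).filter fun x => (l + h) x = 0).card ≤
        (X.filter fun x => ¬ h x = 0).card := by
      rw [← Finset.card_union_of_disjoint]
      · exact Finset.card_le_card (Finset.union_subset (Finset.filter_subset _ _)
          (Finset.filter_subset _ _))
      · rw [Finset.disjoint_left]
        intro x hx hx'
        simp only [Finset.mem_filter, Pi.add_apply] at hx hx'
        rw [hx.2, zero_add] at hx'
        exact hx.1.2 hx'.2
    have hc := Finset.card_filter_add_card_filter_not (s := X) (fun x => h x = 0)
    have h1 := hsplit l
    have h2 := hsplit (l + h)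
    rw [hsame] at h2
    -- Where h = 0, `l` and `l + h` agree and induction applies; where h ≠ 0 they never vanish
    -- together, so one of them vanishes on at most half of these points.
    by_cases hle : 2 * ((X.filter fun x => ¬ h x = 0).filter fun x => l x = 0).card ≤
        (X.filter fun x => ¬ h x = 0).card
    · refine ⟨l, hl, fun x hx => hl0 x fun g hg => hx g (List.mem_cons_of_mem _ hg), by omega⟩
    · refine ⟨l + h, V.add_mem hl (hV h List.mem_cons_self), fun x hx => ?_, by omega⟩
      rw [Pi.add_apply, hl0 x fun g hg => hx g (List.mem_cons_of_mem _ hg),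
        hx h List.mem_cons_self, add_zero]

variable {p : ℕ} [Fact p.Prime] {n : ℕ}

/-- By Fermat, l^(p-1) is the indicator of l ≠ 0. -/
lemma boolIndicator_or_mem {r s : ℕ} {g : (Fin n → Bool) → Bool} {l : (Fin n → Bool) → ZMod p}
    (hg : boolIndicator (ZMod p) g ∈ lowDegree (ZMod p) n r) (hl : l ∈ lowDegree (ZMod p) n s) :
    boolIndicator (ZMod p) (fun x => g x || decide (l x ≠ 0)) ∈
      lowDegree (ZMod p) n (r + s * (p - 1)) := by
  have : boolIndicator (ZMod p) (fun x => g x || decide (l x ≠ 0)) =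
      1 - (1 - boolIndicator (ZMod p) g) * (1 - l ^ (p - 1)) := by
    have hp : p - 1 ≠ 0 := by have := (Fact.out : p.Prime).two_le; omega
    funext x
    simp only [boolIndicator, Pi.sub_apply, Pi.mul_apply, Pi.pow_apply, Pi.one_apply]
    by_cases hlx : l x = 0
    · by_cases hgx : g x = true <;> simp [hgx, hlx, hp]
    · simp [hlx, ZMod.pow_card_sub_one_eq_one hlx]
  rw [this]
  exact Submodule.sub_mem _ (one_mem_lowDegree _) (mul_mem_lowDegree
    (Submodule.sub_mem _ (one_mem_lowDegree _) hg)
    (Submodule.sub_mem _ (one_mem_lowDegree _) (pow_mem_lowDegree hl _)))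

lemma boolIndicator_not (K : Type*) [CommRing K] (g : (Fin n → Bool) → Bool) :
    boolIndicator K (fun x => !(g x)) = 1 - boolIndicator K g := by
  funext x
  cases h : g x <;> simp [boolIndicator, h]

lemma boolIndicator_not_mem {r : ℕ} {g : (Fin n → Bool) → Bool}
    (hg : boolIndicator (ZMod p) g ∈ lowDegree (ZMod p) n r) :
    boolIndicator (ZMod p) (fun x => !(g x)) ∈ lowDegree (ZMod p) n r := by
  rw [boolIndicator_not]
  exact Submodule.sub_mem _ (one_mem_lowDegree _) hg

/-- Razborov's approximation of an OR of functions of degree at most `r`, with one-sided error. -/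
lemma exists_or_approx {r : ℕ} (hs : List ((Fin n → Bool) → ZMod p))
    (hV : ∀ h ∈ hs, h ∈ lowDegree (ZMod p) n r) (t : ℕ) :
    ∃ g : (Fin n → Bool) → Bool, boolIndicator (ZMod p) g ∈ lowDegree (ZMod p) n (r * (p - 1) * t) ∧
      (∀ x, (∀ h ∈ hs, h x = 0) → g x = false) ∧
      (univ.filter fun x => (∃ h ∈ hs, h x ≠ 0) ∧ g x = false).card * 2 ^ t ≤ 2 ^ n := by
  classical
  induction t with
  | zero =>
    refine ⟨fun _ => false, ?_, by simp, ?_⟩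
    · have : boolIndicator (ZMod p) (fun _ : Fin n → Bool => false) = 0 := by
        funext x; simp [boolIndicator]
      rw [this]
      exact Submodule.zero_mem _
    · rw [pow_zero, mul_one, ← card_cube n]
      exact Finset.card_le_univ _
  | succ t ih =>
    obtain ⟨g, hg, hg0, hgX⟩ := ih
    -- Each round halves the set of points still missed; since the error is one-sided, points
    -- already caught stay caught.
    obtain ⟨l, hl, hl0, hlX⟩ := exists_combination_half _ hs hV
      (univ.filter fun x => (∃ h ∈ hs, h x ≠ 0) ∧ g x = false)
      (fun x hx => (Finset.mem_filter.1 hx).2.1)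
    refine ⟨fun x => g x || decide (l x ≠ 0), ?_, ?_, ?_⟩
    · rw [Nat.mul_succ]
      exact boolIndicator_or_mem hg hl
    · intro x hx
      simp [hg0 x hx, hl0 x hx]
    · have : (univ.filter fun x => (∃ h ∈ hs, h x ≠ 0) ∧ (g x || decide (l x ≠ 0)) = false) =
          (univ.filter fun x => (∃ h ∈ hs, h x ≠ 0) ∧ g x = false).filter fun x => l x = 0 := by
        ext x; simp [and_assoc]
      rw [this, pow_succ]
      calc _ = 2 * (Finset.card _) * 2 ^ t := by ring
        _ ≤ _ := (Nat.mul_le_mul_right _ hlX).trans hgX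

/-- Approximation of the OR of a list of Boolean functions of low degree. -/
lemma exists_any_approx {r : ℕ} (gs : List ((Fin n → Bool) → Bool))
    (hV : ∀ g ∈ gs, boolIndicator (ZMod p) g ∈ lowDegree (ZMod p) n r) (t : ℕ) :
    ∃ g : (Fin n → Bool) → Bool, boolIndicator (ZMod p) g ∈ lowDegree (ZMod p) n (r * (p - 1) * t) ∧
      (univ.filter fun x => (gs.any fun f => f x) ≠ g x).card * 2 ^ t ≤ 2 ^ n := by
  obtain ⟨g, hg, hg0, hgX⟩ := exists_or_approx (gs.map (boolIndicator (ZMod p)))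
    (by simpa using hV) t
  refine ⟨g, hg, le_trans (Nat.mul_le_mul_right _ (Finset.card_le_card ?_)) hgX⟩
  intro x
  simp only [Finset.mem_filter, Finset.mem_univ, true_and, List.mem_map]
  intro hx
  have h0 := hg0 x
  simp only [List.mem_map, forall_exists_index, and_imp, forall_apply_eq_imp_iff₂] at h0
  by_cases hany : gs.any (fun f => f x) = true
  · rw [hany] at hx
    refine ⟨?_, by simpa using hx.symm⟩
    obtain ⟨f, hf, hfx⟩ := List.any_eq_true.1 hany
    exact ⟨_, ⟨f, hf, rfl⟩, by simp [boolIndicator, hfx]⟩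
  · refine absurd ?_ hx
    rw [h0, Bool.not_eq_true _ |>.mp hany]
    intro f hf
    simp only [List.any_eq_true, not_exists, not_and] at hany
    simp [boolIndicator, hany f hf]

lemma sum_boolIndicator (gs : List ((Fin n → Bool) → Bool)) (x : Fin n → Bool) :
    (gs.map (boolIndicator (ZMod p))).sum x = ((gs.countP fun f => f x : ℕ) : ZMod p) := by
  induction gs with
  | nil => simp
  | cons g gs ih =>
    rw [List.map_cons, List.sum_cons, Pi.add_apply, ih, List.countP_cons]
    cases h : g x <;> simp [boolIndicator, h, add_comm]

/-- The MOD_`p` of Boolean functions of low degree has low degree. -/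
lemma boolIndicator_mod_mem {r : ℕ} (gs : List ((Fin n → Bool) → Bool))
    (hV : ∀ g ∈ gs, boolIndicator (ZMod p) g ∈ lowDegree (ZMod p) n r) :
    boolIndicator (ZMod p) (fun x => decide (p ∣ gs.countP fun f => f x)) ∈
      lowDegree (ZMod p) n (r * (p - 1)) := by
  have hsum : (gs.map (boolIndicator (ZMod p))).sum ∈ lowDegree (ZMod p) n r :=
    list_sum_mem (by simpa using hV)
  have hzero : boolIndicator (ZMod p) (fun _ : Fin n → Bool => false) ∈ lowDegree (ZMod p) n 0 := by
    have : boolIndicator (ZMod p) (fun _ : Fin n → Bool => false) = 0 := by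
      funext x; simp [boolIndicator]
    rw [this]
    exact Submodule.zero_mem _
  -- MOD_p is the negation of "the sum is nonzero in F_p", so no error occurs.
  have h := boolIndicator_not_mem (boolIndicator_or_mem hzero hsum)
  rw [zero_add] at h
  convert h using 3 with x
  rw [sum_boolIndicator]
  simp [ZMod.natCast_eq_zero_iff]

end Approximation

/-! ### From gates to circuits. -/

namespace ModCircuit

lemma gateDepth_le {p n : ℕ} (C : ModCircuit p n) (m : ℕ) (hm : m < C.size) :
    C.gateDepth ⟨m, hm⟩ ≤ m + 1 := by
  induction m using Nat.strong_induction_on with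
  | _ m ih =>
    have hw : ∀ w : Wire n m,
        w.depth (fun i : Fin m => C.gateDepth ⟨i, i.2.trans hm⟩) ≤ m := by
      intro w
      cases w with
      | lit i b => exact Nat.zero_le _
      | gate j => exact (ih j j.2 _).trans j.2
    have hws : ∀ ws : List (Wire n m),
        (ws.map fun w => w.depth fun i : Fin m => C.gateDepth ⟨i, i.2.trans hm⟩).foldr max 0 ≤
          m := by
      intro ws
      induction ws with
      | nil => exact Nat.zero_le _
      | cons w ws ih => exact max_le (hw w) ih
    rw [gateDepth]
    generalize C.gate ⟨m, hm⟩ = G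
    cases G with
    | notGate w => exact (hw w).trans (Nat.le_succ _)
    | andGate ws => exact Nat.succ_le_succ (hws ws)
    | orGate ws => exact Nat.succ_le_succ (hws ws)
    | modGate ws => exact Nat.succ_le_succ (hws ws)

/-- Bounds the depth of small circuits independently of d, which lets n₀ depend on p only. -/
lemma depth_le_size {p n : ℕ} (C : ModCircuit p n) : C.depth ≤ C.size := by
  unfold depth
  cases C.output with
  | lit i b => exact Nat.zero_le _
  | gate j => exact (C.gateDepth_le j.1 j.2).trans j.2

end ModCircuit

section Circuit

variable {p : ℕ} [Fact p.Prime] {n : ℕ}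

lemma boolIndicator_wire_mem {k K : ℕ} (q : Fin k → (Fin n → Bool) → Bool) (h : Fin k → ℕ)
    (hq : ∀ i, boolIndicator (ZMod p) (q i) ∈ lowDegree (ZMod p) n (K ^ h i)) (w : Wire n k) :
    boolIndicator (ZMod p) (fun x => w.eval x fun i => q i x) ∈
      lowDegree (ZMod p) n (K ^ w.depth h) := by
  cases w with
  | gate j => exact hq j
  | lit i b =>
    have h1 : boolIndicator (ZMod p) (fun x : Fin n → Bool => x i) ∈ lowDegree (ZMod p) n 1 :=
      coord_mem_lowDegree i
    cases b with
    | true => simpa [Wire.eval, Wire.depth] using h1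
    | false =>
      have := boolIndicator_not_mem h1
      simpa [Wire.eval, Wire.depth] using this

lemma depth_le_foldr_max {k : ℕ} (h : Fin k → ℕ) {ws : List (Wire n k)} {w : Wire n k}
    (hw : w ∈ ws) : w.depth h ≤ (ws.map fun w => w.depth h).foldr max 0 :=
  List.le_max_of_le' _ (List.mem_map_of_mem hw) le_rfl

/-- Approximation of a gate whose incoming gates compute Boolean functions of low degree. -/
lemma exists_gate_approx {t k : ℕ} (ht : 1 ≤ t) (G : Gate p n k)
    (q : Fin k → (Fin n → Bool) → Bool) (h : Fin k → ℕ)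
    (hq : ∀ i, boolIndicator (ZMod p) (q i) ∈ lowDegree (ZMod p) n (((p - 1) * t) ^ h i)) :
    ∃ g : (Fin n → Bool) → Bool,
      boolIndicator (ZMod p) g ∈ lowDegree (ZMod p) n (((p - 1) * t) ^ G.depth h) ∧
      (univ.filter fun x => G.eval x (fun i => q i x) ≠ g x).card * 2 ^ t ≤ 2 ^ n := by
  have hp : 1 ≤ p - 1 := by have := (Fact.out : p.Prime).two_le; omega
  have hK : 1 ≤ (p - 1) * t := Nat.mul_pos hp ht
  have hlist : ∀ ws : List (Wire n k),
      ∀ g ∈ ws.map (fun w x => w.eval x fun i => q i x), boolIndicator (ZMod p) g ∈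
        lowDegree (ZMod p) n (((p - 1) * t) ^ (ws.map fun w => w.depth h).foldr max 0) := by
    intro ws g hg
    obtain ⟨w, hw, rfl⟩ := List.mem_map.1 hg
    exact lowDegree_mono (Nat.pow_le_pow_right hK (depth_le_foldr_max h hw))
      (boolIndicator_wire_mem q h hq w)
  have hdeg : ∀ m : ℕ, ((p - 1) * t) ^ m * (p - 1) * t = ((p - 1) * t) ^ (m + 1) := fun m => by
    rw [pow_succ]; ring
  cases G with
  | notGate w =>
    refine ⟨_, boolIndicator_not_mem (boolIndicator_wire_mem q h hq w), ?_⟩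
    simp [Gate.eval]
  | modGate ws =>
    refine ⟨_, lowDegree_mono ?_ (boolIndicator_mod_mem _ (hlist ws)), ?_⟩
    · rw [Gate.depth, ← hdeg]
      exact Nat.le_mul_of_pos_right _ ht
    · simp [Gate.eval, List.countP_map, Function.comp_def]
  | orGate ws =>
    obtain ⟨g, hg, hc⟩ := exists_any_approx _ (hlist ws) t
    rw [hdeg] at hg
    refine ⟨g, hg, ?_⟩
    convert hc using 4 with x
    simp [Gate.eval, List.any_map, Function.comp_def]
  | andGate ws =>
    -- De Morgan: negation does not change the degree bound.
    obtain ⟨g, hg, hc⟩ := exists_any_approx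
      ((ws.map (fun w x => w.eval x fun i => q i x)).map fun f x => !(f x)) (t := t)
      (fun g hg => by
        obtain ⟨f, hf, rfl⟩ := List.mem_map.1 hg
        exact boolIndicator_not_mem (hlist ws f hf))
    rw [hdeg] at hg
    refine ⟨_, boolIndicator_not_mem hg, ?_⟩
    convert hc using 4 with x
    rw [List.map_map, List.any_map, Gate.eval, List.all_eq_not_any_not]
    simp [Function.comp_def]

namespace ModCircuit

/-- Simultaneous approximation of all gates of a circuit. -/
lemma exists_approx_gates {t : ℕ} (ht : 1 ≤ t) (C : ModCircuit p n) :
    ∃ q : Fin C.size → (Fin n → Bool) → Bool, ∀ j : Fin C.size,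
      boolIndicator (ZMod p) (q j) ∈ lowDegree (ZMod p) n (((p - 1) * t) ^ C.gateDepth j) ∧
      (univ.filter fun x =>
        (C.gate j).eval x (fun i => q ⟨i, i.2.trans j.2⟩ x) ≠ q j x).card * 2 ^ t ≤ 2 ^ n := by
  suffices H : ∀ m ≤ C.size, ∃ q : Fin C.size → (Fin n → Bool) → Bool, ∀ j : Fin C.size, j.1 < m →
      boolIndicator (ZMod p) (q j) ∈ lowDegree (ZMod p) n (((p - 1) * t) ^ C.gateDepth j) ∧
      (univ.filter fun x =>
        (C.gate j).eval x (fun i => q ⟨i, i.2.trans j.2⟩ x) ≠ q j x).card * 2 ^ t ≤ 2 ^ n by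
    obtain ⟨q, hq⟩ := H C.size le_rfl
    exact ⟨q, fun j => hq j j.2⟩
  intro m hm
  induction m with
  | zero => exact ⟨fun _ _ => false, fun j hj => absurd hj (Nat.not_lt_zero _)⟩
  | succ m ih =>
    obtain ⟨q, hq⟩ := ih (Nat.le_of_succ_le hm)
    obtain ⟨g, hg, hgc⟩ := exists_gate_approx ht (C.gate ⟨m, hm⟩)
      (fun i => q ⟨i, i.2.trans hm⟩) (fun i => C.gateDepth ⟨i, i.2.trans hm⟩)
      (fun i => (hq ⟨i, i.2.trans hm⟩ i.2).1)
    refine ⟨Function.update q ⟨m, hm⟩ g, fun j hj => ?_⟩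
    have hlow : ∀ i : Fin j, Function.update q ⟨m, hm⟩ g ⟨i, i.2.trans j.2⟩ =
        q ⟨i, i.2.trans j.2⟩ := fun i => Function.update_of_ne (by
      rw [Ne, Fin.mk.injEq]
      have := i.2
      omega) _ _
    simp only [hlow]
    rcases Nat.lt_succ_iff_lt_or_eq.1 hj with hjm | hjm
    · rw [Function.update_of_ne (by rintro rfl; simp at hjm)]
      exact hq j hjm
    · obtain rfl : j = ⟨m, hm⟩ := Fin.ext hjm
      rw [Function.update_self, gateDepth]
      exact ⟨hg, hgc⟩

/-- Razborov's approximation: a circuit of depth `d` agrees with a Boolean function of degree at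
most `((p - 1) t) ^ d` on all but a `size / 2 ^ t` fraction of the inputs. -/
theorem exists_approx {t : ℕ} (ht : 1 ≤ t) (C : ModCircuit p n) :
    ∃ g : (Fin n → Bool) → Bool,
      boolIndicator (ZMod p) g ∈ lowDegree (ZMod p) n (((p - 1) * t) ^ C.depth) ∧
      (univ.filter fun x => C.eval x ≠ g x).card * 2 ^ t ≤ C.size * 2 ^ n := by
  classical
  obtain ⟨q, hq⟩ := C.exists_approx_gates ht
  refine ⟨_, boolIndicator_wire_mem q C.gateDepth (fun i => (hq i).1) C.output, ?_⟩
  -- Errors are local: each gate is compared with its approximant on approximated inputs. Where no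
  -- gate errs locally, all values are exact, so a union bound over gates suffices.
  have hsub : (univ.filter fun x => C.eval x ≠ C.output.eval x fun i => q i x) ⊆
      univ.biUnion fun j => univ.filter fun x =>
        (C.gate j).eval x (fun i => q ⟨i, i.2.trans j.2⟩ x) ≠ q j x := by
    intro x hx
    by_contra hcon
    simp only [Finset.mem_biUnion, Finset.mem_filter, Finset.mem_univ, true_and, not_exists,
      not_not] at hcon
    have hgate : ∀ m (hm : m < C.size), C.gateEval x ⟨m, hm⟩ = q ⟨m, hm⟩ x := by
      intro m
      induction m using Nat.strong_induction_on with
      | _ m ih =>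
        intro hm
        rw [gateEval, ← hcon]
        congr 1
        funext i
        exact ih i i.2 _
    refine (Finset.mem_filter.1 hx).2 ?_
    unfold eval
    congr 1
    funext i
    exact hgate i.1 i.2
  calc _ ≤ (∑ j : Fin C.size, (univ.filter fun x =>
        (C.gate j).eval x (fun i => q ⟨i, i.2.trans j.2⟩ x) ≠ q j x).card) * 2 ^ t :=
        Nat.mul_le_mul_right _ ((Finset.card_le_card hsub).trans Finset.card_biUnion_le)
    _ ≤ ∑ _j : Fin C.size, 2 ^ n := by
        rw [Finset.sum_mul]
        exact Finset.sum_le_sum fun j _ => (hq j).2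
    _ = C.size * 2 ^ n := by simp

/-- A circuit that accepts only inputs of odd weight accepts few inputs. -/
theorem card_accept_mul_le (hp : Odd p) {t : ℕ} (ht : 1 ≤ t) (C : ModCircuit p n)
    (hn : 16 * (((p - 1) * t) ^ C.depth + 1) ^ 2 ≤ n)
    (hC : ∀ x, C.eval x = true → parity x = true) :
    (univ.filter fun x => C.eval x = true).card * 2 ^ t ≤ 5 * (C.size * 2 ^ n) := by
  classical
  obtain ⟨g, hg, hgc⟩ := C.exists_approx ht
  set D := ((p - 1) * t) ^ C.depth
  set E := univ.filter fun x => C.eval x ≠ g x with hE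
  have h2 : (2 : ZMod p) ≠ 0 := by
    intro h
    have : (p : ℕ) ∣ 2 := (ZMod.natCast_eq_zero_iff 2 p).1 (by exact_mod_cast h)
    have h2p := (Nat.prime_dvd_prime_iff_eq Fact.out Nat.prime_two).1 this
    rw [h2p] at hp
    exact absurd hp (by decide)
  have hDn : 4 * D + 4 ≤ n := by nlinarith
  have hmain := card_support_mul_ballCard_le h2
    (by omega : 2 * (D + ((n - 1) / 2 - D)) < n) hg
  have hball := two_pow_le_four_mul_ballCard hn
  have hs : ∀ x, boolIndicator (ZMod p) g x ≠ 0 ↔ g x = true := by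
    intro x; simp [boolIndicator]
  simp only [hs] at hmain
  -- An even input accepted by g is rejected by C, hence an error.
  have heven : (univ.filter fun x => parity x = false ∧ g x = true).card ≤ E.card := by
    refine Finset.card_le_card fun x hx => ?_
    simp only [Finset.mem_filter, Finset.mem_univ, true_and, hE] at hx ⊢
    intro h
    rw [hC x (h.trans hx.2)] at hx
    simp at hx
  have hacc : (univ.filter fun x => C.eval x = true).card ≤
      (univ.filter fun x => g x = true).card + E.card := by
    rw [← tsub_le_iff_right]
    refine (Finset.le_card_sdiff _ _).trans (Finset.card_le_card fun x hx => ?_)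
    simp only [Finset.mem_sdiff, Finset.mem_filter, Finset.mem_univ, true_and, hE, not_not] at hx ⊢
    rw [← hx.2, hx.1]
  have hsupp : (univ.filter fun x => g x = true).card ≤ 4 * E.card := by
    refine le_of_mul_le_mul_right ?_ (Nat.two_pow_pos n)
    calc (univ.filter fun x => g x = true).card * 2 ^ n
        ≤ (univ.filter fun x => g x = true).card * (4 * ballCard n ((n - 1) / 2 - D)) :=
          Nat.mul_le_mul_left _ hball
      _ ≤ 4 * ((univ.filter fun x => parity x = false ∧ g x = true).card * 2 ^ n) := by
          rw [Nat.mul_left_comm]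
          exact Nat.mul_le_mul_left _ hmain
      _ ≤ 4 * (E.card * 2 ^ n) := by gcongr
      _ = 4 * E.card * 2 ^ n := by ring
  calc _ ≤ (5 * E.card) * 2 ^ t := Nat.mul_le_mul_right _ (by omega)
    _ = 5 * (E.card * 2 ^ t) := by ring
    _ ≤ 5 * (C.size * 2 ^ n) := Nat.mul_le_mul_left _ hgc

end ModCircuit

end Circuit

/-! ### The correlation bound and the choice of parameters. -/

/-- Exactly half of the inputs have even weight. -/
lemma two_mul_card_parity_false {n : ℕ} (hn : 0 < n) :
    2 * (univ.filter fun x : Fin n → Bool => parity x = false).card = 2 ^ n := by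
  have h := sum_cubeChar_univ_mul_eq_zero (K := ℤ) hn (one_mem_lowDegree 0)
  simp only [cubeChar_univ_eq, Pi.one_apply, mul_one] at h
  rw [Finset.sum_ite] at h
  simp only [Finset.sum_const, nsmul_eq_mul, mul_neg, mul_one, Bool.not_eq_true] at h
  have hc := Finset.card_filter_add_card_filter_not (s := (univ : Finset (Fin n → Bool)))
    (fun x => parity x = true)
  rw [card_cube] at hc
  simp only [Bool.not_eq_true] at hc
  omega

lemma card_eq_parity {n : ℕ} (f : (Fin n → Bool) → Bool)
    (hf : ∀ x, f x = true → parity x = true) :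
    (univ.filter fun x => f x = parity x).card =
      (univ.filter fun x : Fin n → Bool => parity x = false).card +
        (univ.filter fun x => f x = true).card := by
  classical
  rw [← Finset.card_union_of_disjoint]
  · congr 1
    ext x
    have := hf x
    simp only [Finset.mem_filter, Finset.mem_univ, true_and, Finset.mem_union]
    cases h1 : f x <;> cases h2 : parity x <;> simp_all
  · rw [Finset.disjoint_left]
    intro x hx hx'
    simp only [Finset.mem_filter, Finset.mem_univ, true_and] at hx hx'
    simp [hf x hx'] at hx

lemma agreement_le_one {n : ℕ} (f g : (Fin n → Bool) → Bool) : agreement f g ≤ 1 := by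
  unfold agreement
  rw [div_le_one (by positivity)]
  calc ((univ.filter fun x : Fin n → Bool => f x = g x).card : ℝ)
      ≤ ((univ : Finset (Fin n → Bool)).card : ℝ) := by exact_mod_cast Finset.card_le_univ _
    _ = 2 ^ n := by rw [card_cube]; norm_num

/-- The correlation bound, for a number of rounds `t` such that the degree of the approximation
is small compared to `√n`. -/
lemma agreement_parity_le {p n t : ℕ} [Fact p.Prime] (hp : Odd p) (C : ModCircuit p n)
    (hC : ∀ x, C.eval x = true → parity x = true) {y : ℝ} (hy0 : 0 ≤ y) (hy : y + 3 ≤ t)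
    (hn : 16 * (((p - 1) * t) ^ C.depth + 1) ^ 2 ≤ n) :
    agreement C.eval parity ≤ 1 / 2 + (C.size : ℝ) * (2 : ℝ) ^ (-y) := by
  have ht : 1 ≤ t := by
    have : (1 : ℝ) ≤ t := by linarith
    exact_mod_cast this
  have hn0 : 0 < n := lt_of_lt_of_le (by positivity) hn
  have hacc := C.card_accept_mul_le hp ht hn hC
  have heven := two_mul_card_parity_false hn0
  unfold agreement
  rw [card_eq_parity _ hC]
  set a := (univ.filter fun x => C.eval x = true).card
  set e := (univ.filter fun x : Fin n → Bool => parity x = false).card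
  have hacc' : (a : ℝ) * 2 ^ t ≤ 5 * (C.size * 2 ^ n) := by exact_mod_cast hacc
  have heven' : 2 * (e : ℝ) = 2 ^ n := by exact_mod_cast heven
  have hN : (0 : ℝ) < 2 ^ n := by positivity
  -- The three extra rounds give a factor 8, which absorbs the 5 of `card_accept_mul_le`.
  have h2t : (8 : ℝ) * 2 ^ y ≤ 2 ^ t := by
    calc (8 : ℝ) * 2 ^ y = 2 ^ (y + 3) := by
          rw [Real.rpow_add two_pos, mul_comm]; norm_num
      _ ≤ 2 ^ (t : ℝ) := Real.rpow_le_rpow_of_exponent_le one_le_two hy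
      _ = 2 ^ t := Real.rpow_natCast 2 t
  have hyp : (0 : ℝ) < 2 ^ y := by positivity
  have ha : (a : ℝ) / 2 ^ n ≤ C.size * (2 : ℝ) ^ (-y) := by
    rw [Real.rpow_neg two_pos.le, ← div_eq_mul_inv, div_le_div_iff₀ hN hyp]
    have h8 : (a : ℝ) * (8 * 2 ^ y) ≤ 5 * (C.size * 2 ^ n) :=
      (mul_le_mul_of_nonneg_left h2t (Nat.cast_nonneg _)).trans hacc'
    have hs : (0 : ℝ) ≤ C.size * 2 ^ n := by positivity
    nlinarith
  have he : (e : ℝ) / 2 ^ n = 1 / 2 := by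
    rw [div_eq_div_iff hN.ne' two_ne_zero]
    linarith
  push_cast
  rw [add_div, he]
  linarith

theorem theorem1p4 :
    ∃ c : ℝ, 0 < c ∧ ∀ p : ℕ, p.Prime → Odd p → ∃ n₀ : ℕ, ∀ d : ℕ, 1 ≤ d →
      ∀ n : ℕ, n₀ ≤ n → ∀ C : ModCircuit p n, C.depth ≤ d →
        (∀ x : Fin n → Bool, C.eval x = true → parity x = true) →
        agreement C.eval parity ≤
          1 / 2 + (C.size : ℝ) * (2 : ℝ) ^ (-((n : ℝ) ^ (c / (d : ℝ)))) := by
  refine ⟨1 / 8, by norm_num, fun p hp hodd => ?_⟩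
  have : Fact p.Prime := ⟨hp⟩
  -- 4096 = 8⁴ makes n^(1/4) ≥ 8; the other term handles small circuits when d is large relative to
  -- n.
  refine ⟨max 4096 (16 * ((25 * p ^ 2) ^ 2 ^ (5 * p) + 1) ^ 2), ?_⟩
  intro d hd n hn C hCd hC
  have hn1 : 4096 ≤ n := (le_max_left _ _).trans hn
  have hn2 : 16 * ((25 * p ^ 2) ^ 2 ^ (5 * p) + 1) ^ 2 ≤ n := (le_max_right _ _).trans hn
  have hn1' : (4096 : ℝ) ≤ n := by exact_mod_cast hn1
  set y : ℝ := (n : ℝ) ^ ((1 / 8 : ℝ) / d) with hy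
  have hy1 : 1 ≤ y := Real.one_le_rpow (by linarith) (by positivity)
  have hyd : y ^ d = (n : ℝ) ^ (1 / 8 : ℝ) := by
    rw [hy, ← Real.rpow_natCast, ← Real.rpow_mul (by linarith)]
    congr 1
    field_simp
  set t := ⌈y⌉₊ + 3 with ht
  have hyt : y + 3 ≤ t := by
    rw [ht]; push_cast; linarith [Nat.le_ceil y]
  have hty : (t : ℝ) ≤ 5 * y := by
    rw [ht]; push_cast; linarith [Nat.ceil_lt_add_one (zero_le_one.trans hy1)]
  have hp2 := hp.two_le
  have ht1 : 1 ≤ t := by omega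
  have hK1 : 1 ≤ (p - 1) * t := Nat.mul_pos (by omega) ht1
  -- With (p-1)t ≤ 5py and y^d = n^(1/8), the first case gives degree at most n^(1/4). Otherwise y <
  -- 5p.
  rcases le_or_gt (((5 * p : ℕ) : ℝ) ^ d) ((n : ℝ) ^ (1 / 8 : ℝ)) with hsmall | hlarge
  · refine agreement_parity_le hodd C hC (zero_le_one.trans hy1) hyt ?_
    have hK : (((p - 1) * t : ℕ) : ℝ) ≤ ((5 * p : ℕ) : ℝ) * y := by
      have : (((p - 1) * t : ℕ) : ℝ) ≤ ((p * t : ℕ) : ℝ) := by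
        exact_mod_cast Nat.mul_le_mul_right t (Nat.sub_le p 1)
      push_cast at this ⊢
      nlinarith [(Nat.cast_nonneg p : (0 : ℝ) ≤ p)]
    set z : ℝ := (n : ℝ) ^ (1 / 4 : ℝ) with hz
    have hz4 : z ^ 4 = n := by
      rw [hz, ← Real.rpow_natCast, ← Real.rpow_mul (by linarith)]
      norm_num
    have hz8 : 8 ≤ z := by
      refine le_of_pow_le_pow_left₀ four_ne_zero (by positivity) ?_
      rw [hz4]; norm_num; linarith
    have hD : ((((p - 1) * t) ^ C.depth : ℕ) : ℝ) ≤ z := by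
      calc ((((p - 1) * t) ^ C.depth : ℕ) : ℝ) ≤ ((((p - 1) * t) ^ d : ℕ) : ℝ) := by
            exact_mod_cast Nat.pow_le_pow_right hK1 hCd
        _ = (((p - 1) * t : ℕ) : ℝ) ^ d := by rw [Nat.cast_pow]
        _ ≤ (((5 * p : ℕ) : ℝ) * y) ^ d := pow_le_pow_left₀ (Nat.cast_nonneg _) hK d
        _ = ((5 * p : ℕ) : ℝ) ^ d * y ^ d := mul_pow _ _ _
        _ ≤ (n : ℝ) ^ (1 / 8 : ℝ) * (n : ℝ) ^ (1 / 8 : ℝ) := by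
            rw [hyd]; exact mul_le_mul_of_nonneg_right hsmall (by positivity)
        _ = z := by rw [hz, ← Real.rpow_add (by linarith)]; norm_num
    have hgoal : (16 : ℝ) * (((((p - 1) * t) ^ C.depth : ℕ) : ℝ) + 1) ^ 2 ≤ n := by
      calc (16 : ℝ) * (((((p - 1) * t) ^ C.depth : ℕ) : ℝ) + 1) ^ 2 ≤ 16 * (2 * z) ^ 2 := by
            gcongr; linarith
        _ = 64 * z ^ 2 := by ring
        _ ≤ z ^ 2 * z ^ 2 := by gcongr; nlinarith
        _ = n := by rw [← hz4]; ring
    exact_mod_cast hgoal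
  · have hy5 : y < ((5 * p : ℕ) : ℝ) := by
      rw [← hyd] at hlarge
      exact lt_of_pow_lt_pow_left₀ d (Nat.cast_nonneg _) hlarge
    -- As y < 5p, a circuit with at least 2^(5p) gates makes the bound trivial. A smaller one has
    -- depth below 2^(5p) and t ≤ 25p, so its degree is bounded in terms of p alone.
    rcases le_or_gt (2 ^ (5 * p)) C.size with hbig | hsize
    · have h1 : (1 : ℝ) ≤ C.size * (2 : ℝ) ^ (-y) := by
        rw [Real.rpow_neg two_pos.le, ← div_eq_mul_inv, one_le_div (by positivity)]
        calc (2 : ℝ) ^ y ≤ (2 : ℝ) ^ ((5 * p : ℕ) : ℝ) :=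
              Real.rpow_le_rpow_of_exponent_le one_le_two hy5.le
          _ = ((2 ^ (5 * p) : ℕ) : ℝ) := by rw [Real.rpow_natCast]; push_cast; rfl
          _ ≤ C.size := by exact_mod_cast hbig
      linarith [agreement_le_one C.eval (parity (n := n))]
    · refine agreement_parity_le hodd C hC (zero_le_one.trans hy1) hyt (le_trans ?_ hn2)
      have ht25 : t ≤ 25 * p := by
        have : (t : ℝ) ≤ ((25 * p : ℕ) : ℝ) := by
          push_cast at hy5 ⊢
          linarith
        exact_mod_cast this
      have hK : (p - 1) * t ≤ 25 * p ^ 2 := by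
        calc (p - 1) * t ≤ p * (25 * p) := Nat.mul_le_mul (Nat.sub_le p 1) ht25
          _ = 25 * p ^ 2 := by ring
      have hD : ((p - 1) * t) ^ C.depth ≤ (25 * p ^ 2) ^ 2 ^ (5 * p) :=
        (Nat.pow_le_pow_left hK _).trans
          (Nat.pow_le_pow_right (by positivity) (C.depth_le_size.trans hsize.le))
      gcongr
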